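/- Let $\mathcal G$ be a weighted digraph with adjacency weights $a_{vw}\ge 0$ (an edge from $w$ to $v$ exists iff $a_{vw}>0$; no self-loops) on $n$ followers $1,\dots,n$ and $m$ leaders $n+1,\dots,n+m$, where leaders have no incoming edges. Assume $\mathcal G$ is acyclic and every follower is reached by a directed path from at least one leader. Let $L_1\in\mathbb R^{n\times n}$ be the follower–follower block of the Laplacian of $\mathcal G$, and for each follower $i$ let $\lambda_i=(L_1)_{ii}=\sum_{j=1}^{n+m}a_{ij}$; since $\mathcal G$ is acyclic, $\lambda_1,\dots,\lambda_n$ are the eigenvalues of $L_1$ with multiplicity. The followers are $\dot x_i=A_ix_i+B_iu_i$, $y_i=C_ix_i$ with $x_i\in\mathbb R^{N_i}$, $u_i\in\mathbb R^{p_i}$, $y_i\in\mathbb R^q$, and the leaders are $\dot\omega_k=S\omega_k$, $y_k=D\omega_k$ with $\omega_k\in\mathbb R^{\bar q}$, where $S$ is marginally stable (all its eigenvalues have nonpositive real part, and those on the imaginary axis are semisimple). Assume that for every follower $i$ the matrices $\Pi_i,\Gamma_i$ satisfy the regulator equations $\Pi_iS=A_i\Pi_i+B_i\Gamma_i$ and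 $D=C_i\Pi_i$. Design the gains as follows. For each $i$ let $E_i\in\mathbb R^{N_i\times N_i}$ and $R_i\in\mathbb R^{q\times q}$ be symmetric positive definite, let $\Phi_i$ be a symmetric positive definite solution of $$A_i\Phi_i+\Phi_iA_i^T+E_i-\Phi_iC_i^TR_i^{-1}C_i\Phi_i=0,$$ and put $F_i=\Phi_iC_i^TR_i^{-1}$; let $\mu_i\ge\frac1{2\lambda_i}$ (this holds in particular if $\mu_i\ge 1/(2\min_j\lambda_j)$); let $K_i^1$ be such that $A_i+B_iK_i^1$ is Hurwitz; put $K_i^2=\Gamma_i-K_i^1\Pi_i$; and let $\beta>0$ be arbitrary. Consider the relative-output-feedback protocol $$u_i=K_i^1\xi_i+K_i^2\eta_i,$$ $$\dot\xi_i=A_i\xi_i+B_iu_i-\mu_iF_i\Big(\sum_{j=1}^na_{ij}\big((y_j-y_i)+C_i\xi_i-C_j\xi_j\big)+\sum_{k=n+1}^{n+m}a_{ik}\big((y_k-y_i)+C_i\xi_i-D\omega_k\big)\Big),$$ $$\dot\eta_i=S\eta_i+\beta\Big(\sum_{j=1}^na_{ij}(\eta_j-\eta_i)+\sum_{k=n+1}^{n+m}a_{ik}(\omega_k-\eta_i)\Big).$$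 Write $A,\bar B,\bar C,K_1,K_2,F$ for the block-diagonal matrices with blocks $A_i,B_i,C_i,K_i^1,K_i^2,F_i$, put $\mu=\mathrm{diag}(\mu_1I_{N_1},\dots,\mu_nI_{N_n})$, and let $M=\mu F(L_1\otimes I_q)\bar C$. Then: (1) the closed-loop matrix $$A_c=\begin{bmatrix}A&\bar BK_1&\bar BK_2\\ M&A+\bar BK_1-M&\bar BK_2\\ 0&0&I_n\otimes S-L_1\otimes\beta I_{\bar q}\end{bmatrix}$$ is Hurwitz (all its eigenvalues have negative real part); (2) for all initial conditions $x_i(0),\xi_i(0),\eta_i(0)$ $(1\le i\le n)$ and $\omega_k(0)$ $(n+1\le k\le n+m)$ the closed-loop system has a solution on $[0,\infty)$, and along every such solution each containment error $$e_i(t)=\sum_{j=1}^na_{ij}\,(y_i(t)-y_j(t))+\sum_{k=n+1}^{n+m}a_{ik}\,(y_i(t)-y_k(t))$$ tends to $0$ as $t\to\infty$. -/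

import Mathlib

open Matrix Filter Topology

/-- A weighted digraph on `n` followers (`Sum.inl i`) and `m` leaders (`Sum.inr k`).
`weight v w` is the entry `a_{vw}` of the adjacency matrix; there is an edge from `w` to `v`
exactly when `a_{vw} > 0`. Leaders are agents that receive no information. -/
structure LeaderFollowerGraph (n m : ℕ) where
  /-- the weighted adjacency matrix -/
  weight : Matrix (Fin n ⊕ Fin m) (Fin n ⊕ Fin m) ℝ
  weight_nonneg : ∀ v w, 0 ≤ weight v w
  no_self_loop : ∀ v, weight v v = 0
  leader_no_neighbor : ∀ (k : Fin m) (w : Fin n ⊕ Fin m), weight (Sum.inr k) w = 0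

namespace LeaderFollowerGraph

variable {n m : ℕ} (G : LeaderFollowerGraph n m)

/-- `G.Edge w v`: there is an edge from `w` (parent) to `v` (child). -/
def Edge (w v : Fin n ⊕ Fin m) : Prop := 0 < G.weight v w

/-- There is no directed cycle. -/
def Acyclic : Prop := ∀ v, ¬ Relation.TransGen G.Edge v v

/-- Every follower is reached by a directed path from at least one leader. -/
def EveryFollowerReached : Prop :=
  ∀ i : Fin n, ∃ k : Fin m, Relation.TransGen G.Edge (Sum.inr k) (Sum.inl i)

/-- The Laplacian: `ℓ_vv = ∑ w, a_vw` and `ℓ_vw = -a_vw` for `v ≠ w`. -/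
def laplacian : Matrix (Fin n ⊕ Fin m) (Fin n ⊕ Fin m) ℝ :=
  Matrix.of fun v w => if v = w then ∑ u, G.weight v u else - G.weight v w

/-- The follower-follower block `L₁` of the Laplacian. -/
def L₁ : Matrix (Fin n) (Fin n) ℝ := G.laplacian.toBlocks₁₁

/-- The eigenvalue `λ_i` of `L₁` that belongs to follower `i`. For an acyclic graph `L₁` is
triangular after relabelling the followers, and its eigenvalues, with multiplicity, are its
diagonal entries: see `charpoly_L₁`. -/
def eigenvalue (i : Fin n) : ℝ := G.L₁ i i

end LeaderFollowerGraph

/-- A real square matrix is Hurwitz if all its complex eigenvalues have negative real part. -/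
def IsHurwitz {ι : Type*} [Fintype ι] [DecidableEq ι] (M : Matrix ι ι ℝ) : Prop :=
  ∀ z ∈ spectrum ℂ (M.map (algebraMap ℝ ℂ)), z.re < 0

/-- `ẋ = M x` is marginally stable: all complex eigenvalues of `M` have nonpositive real part,
and those on the imaginary axis are semisimple. -/
def IsMarginallyStable {ι : Type*} [Fintype ι] [DecidableEq ι] (M : Matrix ι ι ℝ) : Prop :=
  ∀ z ∈ spectrum ℂ (M.map (algebraMap ℝ ℂ)), z.re ≤ 0 ∧
    (z.re = 0 →
      Module.End.maxGenEigenspace (Matrix.toLin' (M.map (algebraMap ℝ ℂ))) z =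
        Module.End.eigenspace (Matrix.toLin' (M.map (algebraMap ℝ ℂ))) z)

/-- Heterogeneous followers `ẋ_i = A_i x_i + B_i u_i`, `y_i = C_i x_i` and homogeneous leaders
`ω̇_k = S ω_k`, `y_k = D ω_k`. -/
structure AgentDynamics {n : ℕ} (N p : Fin n → ℕ) (q r : ℕ) where
  A : ∀ i, Matrix (Fin (N i)) (Fin (N i)) ℝ
  B : ∀ i, Matrix (Fin (N i)) (Fin (p i)) ℝ
  C : ∀ i, Matrix (Fin q) (Fin (N i)) ℝ
  S : Matrix (Fin r) (Fin r) ℝ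
  D : Matrix (Fin q) (Fin r) ℝ

/-- The gains `K_i¹, K_i², F_i, μ_i, β` of the distributed control protocol. -/
structure ProtocolGains {n : ℕ} (N p : Fin n → ℕ) (q r : ℕ) where
  K₁ : ∀ i, Matrix (Fin (p i)) (Fin (N i)) ℝ
  K₂ : ∀ i, Matrix (Fin (p i)) (Fin r) ℝ
  F : ∀ i, Matrix (Fin (N i)) (Fin q) ℝ
  μ : Fin n → ℝ
  β : ℝ

namespace ContainmentControl

variable {n m : ℕ} {N p : Fin n → ℕ} {q r : ℕ}
variable (G : LeaderFollowerGraph n m) (P : AgentDynamics N p q r) (g : ProtocolGains N p q r)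

/-- Identifies the stacked index `(i, a)` of `n` blocks of equal size with the index used by the
Kronecker product. -/
abbrev stack (n d : ℕ) : (Σ _ : Fin n, Fin d) ≃ Fin n × Fin d := Equiv.sigmaEquivProd _ _

/-- `A = diag(A_1, …, A_n)`. -/
def Abar : Matrix (Σ i, Fin (N i)) (Σ i, Fin (N i)) ℝ := blockDiagonal' P.A

/-- `B̄ = diag(B_1, …, B_n)`. -/
def Bbar : Matrix (Σ i, Fin (N i)) (Σ i, Fin (p i)) ℝ := blockDiagonal' P.B

/-- `C̄ = diag(C_1, …, C_n)`. -/
def Cbar : Matrix (Fin n × Fin q) (Σ i, Fin (N i)) ℝ :=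
  (blockDiagonal' P.C).submatrix (stack n q).symm id

/-- `K₁ = diag(K_1¹, …, K_n¹)`. -/
def K₁bar : Matrix (Σ i, Fin (p i)) (Σ i, Fin (N i)) ℝ := blockDiagonal' g.K₁

/-- `K₂ = diag(K_1², …, K_n²)`. -/
def K₂bar : Matrix (Σ i, Fin (p i)) (Fin n × Fin r) ℝ :=
  (blockDiagonal' g.K₂).submatrix id (stack n r).symm

/-- `F = diag(F_1, …, F_n)`. -/
def Fbar : Matrix (Σ i, Fin (N i)) (Fin n × Fin q) ℝ :=
  (blockDiagonal' g.F).submatrix id (stack n q).symm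

/-- `μ = diag(μ_1 I, …, μ_n I)`. -/
def μbar : Matrix (Σ i, Fin (N i)) (Σ i, Fin (N i)) ℝ := diagonal fun s => g.μ s.1

open scoped Kronecker in
/-- `μ F (L₁ ⊗ I_q) C̄`. -/
def observerCoupling : Matrix (Σ i, Fin (N i)) (Σ i, Fin (N i)) ℝ :=
  μbar g * Fbar g * (G.L₁ ⊗ₖ (1 : Matrix (Fin q) (Fin q) ℝ)) * Cbar P

open scoped Kronecker in
/-- The matrix `A_c` of the closed-loop system, acting on the stacked state `(X, ξ, η)`:
```
    [ A                  B̄ K₁                           B̄ K₂              ]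
    [ μ F (L₁ ⊗ I) C̄    A + B̄ K₁ - μ F (L₁ ⊗ I) C̄    B̄ K₂              ]
    [ 0                  0                               I ⊗ S - L₁ ⊗ β I  ]
```
-/
def closedLoopMatrix :
    Matrix ((Σ i, Fin (N i)) ⊕ ((Σ i, Fin (N i)) ⊕ (Fin n × Fin r)))
      ((Σ i, Fin (N i)) ⊕ ((Σ i, Fin (N i)) ⊕ (Fin n × Fin r))) ℝ :=
  fromBlocks (Abar P) (fromCols (Bbar P * K₁bar g) (Bbar P * K₂bar g))
    (fromRows (observerCoupling G P g) 0)
    (fromBlocks (Abar P + Bbar P * K₁bar g - observerCoupling G P g) (Bbar P * K₂bar g)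
      0 ((1 : Matrix (Fin n) (Fin n) ℝ) ⊗ₖ P.S - G.L₁ ⊗ₖ (g.β • (1 : Matrix (Fin r) (Fin r) ℝ))))

/-- The control input `u_i = K_i¹ ξ_i + K_i² η_i`. -/
def control (i : Fin n) (ξ : Fin (N i) → ℝ) (η : Fin r → ℝ) : Fin (p i) → ℝ :=
  g.K₁ i *ᵥ ξ + g.K₂ i *ᵥ η

/-- The relative output signal that drives the state observer of follower `i`:
`∑ j, a_ij ((y_j - y_i) + ŷ_i - ŷ_j) + ∑ k, a_ik ((y_k - y_i) + ŷ_i - D ω_k)`,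
with `y_j = C_j x_j`, `ŷ_j = C_j ξ_j` and `y_k = D ω_k`. -/
def observerSignal (x ξ : ∀ i, Fin (N i) → ℝ) (ω : Fin m → Fin r → ℝ) (i : Fin n) :
    Fin q → ℝ :=
  ∑ j : Fin n, G.weight (Sum.inl i) (Sum.inl j) •
      ((P.C j *ᵥ x j - P.C i *ᵥ x i) + P.C i *ᵥ ξ i - P.C j *ᵥ ξ j) +
    ∑ k : Fin m, G.weight (Sum.inl i) (Sum.inr k) •
      ((P.D *ᵥ ω k - P.C i *ᵥ x i) + P.C i *ᵥ ξ i - P.D *ᵥ ω k)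

/-- The containment error `e_i = ∑ j, a_ij (y_i - y_j) + ∑ k, a_ik (y_i - y_k)`. -/
def containmentError (x : ∀ i, Fin (N i) → ℝ) (ω : Fin m → Fin r → ℝ) (i : Fin n) :
    Fin q → ℝ :=
  ∑ j : Fin n, G.weight (Sum.inl i) (Sum.inl j) • (P.C i *ᵥ x i - P.C j *ᵥ x j) +
    ∑ k : Fin m, G.weight (Sum.inl i) (Sum.inr k) • (P.C i *ᵥ x i - P.D *ᵥ ω k)

/-- `(x, ξ, η, ω)` is a trajectory on `[0, ∞)` of the followers and leaders under the distributed
protocol: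
`ẋ_i = A_i x_i + B_i u_i`, `u_i = K_i¹ ξ_i + K_i² η_i`,
`ξ̇_i = A_i ξ_i + B_i u_i - μ_i F_i (observerSignal)_i`,
`η̇_i = S η_i + β (∑ j, a_ij (η_j - η_i) + ∑ k, a_ik (ω_k - η_i))`, `ω̇_k = S ω_k`. -/
structure IsTrajectory (x ξ : ℝ → ∀ i, Fin (N i) → ℝ) (η : ℝ → Fin n → Fin r → ℝ)
    (ω : ℝ → Fin m → Fin r → ℝ) : Prop where
  follower : ∀ i, ∀ t, 0 ≤ t → HasDerivWithinAt (fun s => x s i)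
    (P.A i *ᵥ x t i + P.B i *ᵥ control g i (ξ t i) (η t i)) (Set.Ici 0) t
  stateObserver : ∀ i, ∀ t, 0 ≤ t → HasDerivWithinAt (fun s => ξ s i)
    (P.A i *ᵥ ξ t i + P.B i *ᵥ control g i (ξ t i) (η t i)
      - g.μ i • g.F i *ᵥ observerSignal G P (x t) (ξ t) (ω t) i) (Set.Ici 0) t
  leaderObserver : ∀ i, ∀ t, 0 ≤ t → HasDerivWithinAt (fun s => η s i)
    (P.S *ᵥ η t i + g.β •
      (∑ j : Fin n, G.weight (Sum.inl i) (Sum.inl j) • (η t j - η t i) +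
        ∑ k : Fin m, G.weight (Sum.inl i) (Sum.inr k) • (ω t k - η t i))) (Set.Ici 0) t
  leader : ∀ k, ∀ t, 0 ≤ t → HasDerivWithinAt (fun s => ω s k) (P.S *ᵥ ω t k) (Set.Ici 0) t

/-- The cooperative output regulation problem is solved by the protocol: the closed-loop matrix is
Hurwitz; and for all initial conditions the closed loop has a trajectory on `[0, ∞)`, and along
every such trajectory the containment error tends to zero. -/
def SolvesCooperativeOutputRegulation : Prop :=
  IsHurwitz (closedLoopMatrix G P g) ∧
  ∀ (x₀ ξ₀ : ∀ i, Fin (N i) → ℝ) (η₀ : Fin n → Fin r → ℝ) (ω₀ : Fin m → Fin r → ℝ),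
    (∃ x ξ η ω, IsTrajectory G P g x ξ η ω ∧ x 0 = x₀ ∧ ξ 0 = ξ₀ ∧ η 0 = η₀ ∧ ω 0 = ω₀) ∧
    ∀ x ξ η ω, IsTrajectory G P g x ξ η ω → x 0 = x₀ → ξ 0 = ξ₀ → η 0 = η₀ → ω 0 = ω₀ →
      Tendsto (fun t => containmentError G P (x t) (ω t)) atTop (𝓝 0)

end ContainmentControl

/-- The characteristic polynomial of a matrix whose off-diagonal support has no directed cycle. -/
theorem charpoly_of_acyclic {ι : Type*} [Fintype ι] [DecidableEq ι] (M : Matrix ι ι ℝ)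
    (e : ι → ι → Prop) (he : ∀ i, ¬ Relation.TransGen e i i)
    (hM : ∀ i j, i ≠ j → M i j ≠ 0 → e j i) :
    M.charpoly = ∏ i, (Polynomial.X - Polynomial.C (M i i)) := by
  classical
  obtain ⟨s, hs, hle⟩ : ∃ s : ι → ι → Prop, IsLinearOrder ι s ∧
      ∀ i j, Relation.ReflTransGen e j i → s i j := by
    let po : PartialOrder ι :=
      { le := fun i j => Relation.ReflTransGen e j i
        le_refl := fun i => Relation.ReflTransGen.refl
        le_trans := fun i j k h₁ h₂ => h₂.trans h₁
        le_antisymm := fun i j h₁ h₂ => by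
          rcases Relation.reflTransGen_iff_eq_or_transGen.1 h₁ with h | h
          · exact h
          · exact absurd (h.trans_left h₂) (he _) }
    obtain ⟨s, hs, hle⟩ := extend_partialOrder po.le
    exact ⟨s, hs, fun i j h => hle i j h⟩
  let lo : LinearOrder ι :=
    { le := s
      le_refl := hs.refl
      le_trans := fun _ _ _ => hs.trans _ _ _
      le_antisymm := fun _ _ => hs.antisymm _ _
      le_total := hs.total
      toDecidableLE := Classical.decRel _ }
  have hbt : M.BlockTriangular id := by
    intro i j hij
    by_contra hc
    have h1 : i ≤ j := hle _ _ (Relation.ReflTransGen.single (hM i j (ne_of_gt hij) hc))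
    exact (not_le_of_gt hij) h1
  convert Matrix.charpoly_of_isUpperTriangular M hbt

namespace LeaderFollowerGraph

variable {n m : ℕ} (G : LeaderFollowerGraph n m)

/-- For an acyclic graph the numbers `λ_i` are the eigenvalues of `L₁` with multiplicity. -/
theorem charpoly_L₁ (hG : G.Acyclic) :
    G.L₁.charpoly = ∏ i, (Polynomial.X - Polynomial.C (G.eigenvalue i)) := by
  refine charpoly_of_acyclic G.L₁ (fun i j => G.Edge (Sum.inl i) (Sum.inl j)) ?_ ?_
  · intro i hi
    exact hG (Sum.inl i) (Relation.TransGen.lift (p := G.Edge) Sum.inl (fun _ _ h => h) _ _ hi)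
  · intro i j hij h
    refine lt_of_le_of_ne (G.weight_nonneg _ _) fun hw => h ?_
    simp [L₁, laplacian, Matrix.toBlocks₁₁, hij, ← hw]

end LeaderFollowerGraph

/-! ### Complex eigenpairs of real matrices and Lyapunov's criterion. -/

section SpectrumPairs

variable {ι : Type*} [Fintype ι] [DecidableEq ι]

/-! Stability. An eigenvector of `A_c` for `z` with `Re z ≥ 0` must vanish, by a cascade. Acyclicity
lets each coupled equation be solved follower by follower: once the neighbours' components are zero,
row `i` of `L₁` reduces to `λ_i` (`follower_induction`). So `η_i` satisfies `S η_i = (z + β λ_i)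
η_i`, impossible for `η_i ≠ 0`. The estimation error `x_i - ξ_i` is then governed by `A_i - μ_i λ_i
F_i C_i`, Hurwitz by the Riccati equation (`isHurwitz_observerBlock`), and finally `x_i` by `A_i +
B_i K_i¹`.

Regulation. Since `det L₁ = ∏ λ_i ≠ 0`, there is `W` with `L₁ W` equal to the follower-leader
weights. The targets `w_i = ∑ W_ik ω_k` obey `ẇ_i = S w_i`, and the regulator equations make `(Π_i
w_i, Π_i w_i, w_i)` a steady state: the deviation from it obeys `ż = A_c z` exactly
(`isTrajectory_iff`). The containment error is a linear function of that deviation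
(`containmentError_eq`), hence tends to zero. -/

theorem exists_eigenvector_iff_mem_spectrum (M : Matrix ι ι ℂ) (z : ℂ) :
    z ∈ spectrum ℂ M ↔ ∃ v, v ≠ 0 ∧ M *ᵥ v = z • v := by
  rw [spectrum.mem_iff, Matrix.isUnit_iff_isUnit_det, isUnit_iff_ne_zero, not_not,
    ← Matrix.exists_mulVec_eq_zero_iff]
  simp only [Algebra.algebraMap_eq_smul_one, sub_mulVec, smul_mulVec, one_mulVec, sub_eq_zero]
  exact exists_congr fun v => and_congr_right fun _ => eq_comm

/-- A complex eigenvector of a real matrix, split into its real and imaginary part. -/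
theorem exists_realPair_of_mem_spectrum {M : Matrix ι ι ℝ} {z : ℂ}
    (hz : z ∈ spectrum ℂ (M.map (algebraMap ℝ ℂ))) :
    ∃ a b : ι → ℝ, (a ≠ 0 ∨ b ≠ 0) ∧ M *ᵥ a = z.re • a - z.im • b ∧
      M *ᵥ b = z.re • b + z.im • a := by
  obtain ⟨v, hv, h⟩ := (exists_eigenvector_iff_mem_spectrum _ _).1 hz
  refine ⟨fun i => (v i).re, fun i => (v i).im, ?_, ?_, ?_⟩
  · by_contra! hc
    exact hv (funext fun i => Complex.ext (congrFun hc.1 i) (congrFun hc.2 i))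
  · ext i
    have := congrArg Complex.re (congrFun h i)
    simpa [mulVec, dotProduct] using this
  · ext i
    have := congrArg Complex.im (congrFun h i)
    simpa [mulVec, dotProduct] using this

/-- The two equations say that `a + ib` satisfies the eigenvector equation for `z`. In this form
each block of the cascade is eliminated. -/
theorem realPair_eq_zero {M : Matrix ι ι ℝ} {z : ℂ}
    (hz : z ∉ spectrum ℂ (M.map (algebraMap ℝ ℂ))) {a b : ι → ℝ}
    (ha : M *ᵥ a = z.re • a - z.im • b) (hb : M *ᵥ b = z.re • b + z.im • a) :
    a = 0 ∧ b = 0 := by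
  by_contra hc
  refine hz ((exists_eigenvector_iff_mem_spectrum _ _).2
    ⟨fun i => ⟨a i, b i⟩, fun h => hc ⟨?_, ?_⟩, ?_⟩)
  · ext i; exact congrArg Complex.re (congrFun h i)
  · ext i; exact congrArg Complex.im (congrFun h i)
  · ext i
    refine Complex.ext ?_ ?_
    · simpa [mulVec, dotProduct] using congrFun ha i
    · simpa [mulVec, dotProduct] using congrFun hb i

theorem spectrum_complexified_transpose (M : Matrix ι ι ℝ) :
    spectrum ℂ (Mᵀ.map (algebraMap ℝ ℂ)) = spectrum ℂ (M.map (algebraMap ℝ ℂ)) := by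
  ext z
  rw [spectrum.mem_iff, spectrum.mem_iff, Matrix.isUnit_iff_isUnit_det,
    Matrix.isUnit_iff_isUnit_det, ← Matrix.det_transpose]
  simp [Algebra.algebraMap_eq_smul_one, Matrix.transpose_map]

/-- Lyapunov's criterion. -/
theorem IsHurwitz.of_lyapunov {M Φ Q : Matrix ι ι ℝ} (hΦ : Φ.PosDef) (hQ : Q.PosDef)
    (h : M * Φ + Φ * Mᵀ = -Q) : IsHurwitz M := by
  intro z hz
  -- The form of `M Φ + Φ Mᵀ` at `u` is `2 uᵀ Φ Mᵀ u`, so it is eigenvectors of `Mᵀ` that evaluate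
  -- it.
  rw [← spectrum_complexified_transpose] at hz
  obtain ⟨a, b, hab, ha, hb⟩ := exists_realPair_of_mem_spectrum hz
  have hΦs : Φᵀ = Φ := by simpa using hΦ.isHermitian.eq
  have symm : ∀ u v : ι → ℝ, u ⬝ᵥ Φ *ᵥ v = v ⬝ᵥ Φ *ᵥ u := by
    intro u v
    rw [dotProduct_mulVec, ← mulVec_transpose, hΦs, dotProduct_comm]
  have key : ∀ u : ι → ℝ, u ⬝ᵥ Q *ᵥ u = -(2 * (u ⬝ᵥ Φ *ᵥ (Mᵀ *ᵥ u))) := by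
    intro u
    have h1 : u ⬝ᵥ (M * Φ) *ᵥ u = u ⬝ᵥ Φ *ᵥ (Mᵀ *ᵥ u) := by
      rw [← mulVec_mulVec, dotProduct_mulVec, ← mulVec_transpose, symm]
    have h2 := congrArg (fun X : Matrix ι ι ℝ => u ⬝ᵥ X *ᵥ u) h
    simp only [add_mulVec, neg_mulVec, dotProduct_add, dotProduct_neg, h1] at h2
    rw [← mulVec_mulVec] at h2
    linarith
  have nn : ∀ {X : Matrix ι ι ℝ}, X.PosDef → ∀ u, 0 ≤ u ⬝ᵥ X *ᵥ u := fun hX u => by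
    simpa using hX.posSemidef.dotProduct_mulVec_nonneg u
  have pp : ∀ X : Matrix ι ι ℝ, X.PosDef → 0 < a ⬝ᵥ X *ᵥ a + b ⬝ᵥ X *ᵥ b := fun X hX => by
    rcases hab with h | h
    · have : 0 < a ⬝ᵥ X *ᵥ a := by simpa using hX.dotProduct_mulVec_pos h
      linarith [nn hX b]
    · have : 0 < b ⬝ᵥ X *ᵥ b := by simpa using hX.dotProduct_mulVec_pos h
      linarith [nn hX a]
  have hq := pp Q hQ
  have hp := pp Φ hΦ
  -- In the sum over `a` and `b` the terms with `Im z` cancel by symmetry of `Φ`, leaving `-2 Re z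
  -- (aᵀΦa + bᵀΦb) > 0`.
  rw [key a, key b, ha, hb] at hq
  simp only [mulVec_add, mulVec_sub, mulVec_smul, dotProduct_add, dotProduct_sub, dotProduct_smul,
    smul_eq_mul] at hq
  rw [symm b a] at hq
  by_contra! hc
  nlinarith

end SpectrumPairs

/-! ### Linear systems with constant coefficients. -/

section LinearODE

variable {ι : Type*} [Fintype ι]

/-- Differentiating a truncated exponential series shifts its coefficients by one. -/
theorem hasDerivAt_sum_pow_div_factorial_smul {V : Type*} [NormedAddCommGroup V]
    [NormedSpace ℂ V] (u : ℕ → V) (k : ℕ) (t : ℝ) :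
    HasDerivAt (fun t : ℝ => ∑ j ∈ Finset.range (k + 1), ((t : ℂ) ^ j / (j.factorial : ℂ)) • u j)
      (∑ j ∈ Finset.range k, ((t : ℂ) ^ j / (j.factorial : ℂ)) • u (j + 1)) t := by
  induction k with
  | zero => simpa using hasDerivAt_const t (u 0)
  | succ k ih =>
    have h : HasDerivAt (fun t : ℝ => ((t : ℂ) ^ (k + 1) / ((k + 1).factorial : ℂ)) • u (k + 1))
        (((t : ℂ) ^ k / (k.factorial : ℂ)) • u (k + 1)) t := by
      refine HasDerivAt.smul_const ?_ _
      have h0 : HasDerivAt (fun t : ℝ => (t : ℂ)) 1 t := by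
        simpa using (hasDerivAt_id t).ofReal_comp
      refine ((h0.pow (k + 1)).div_const ((k + 1).factorial : ℂ)).congr_deriv ?_
      have h1 : (k.factorial : ℂ) ≠ 0 := by exact_mod_cast k.factorial_ne_zero
      have h2 : (k : ℂ) + 1 ≠ 0 := by exact_mod_cast k.succ_ne_zero
      rw [Nat.factorial_succ]
      push_cast
      field_simp
    rw [Finset.sum_range_succ]
    simp_rw [Finset.sum_range_succ _ (k + 1)]
    exact ih.add h

theorem tendsto_exp_mul_pow_div_factorial {z : ℂ} (hz : z.re < 0) (j : ℕ) :
    Tendsto (fun t : ℝ => Complex.exp (z * t) * ((t : ℂ) ^ j / (j.factorial : ℂ))) atTop (𝓝 0) := by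
  rw [tendsto_zero_iff_norm_tendsto_zero]
  have h := (tendsto_rpow_mul_exp_neg_mul_atTop_nhds_zero j (-z.re) (by linarith)).div_const
    (j.factorial : ℝ)
  rw [zero_div] at h
  refine h.congr' ?_
  filter_upwards [eventually_ge_atTop 0] with t ht
  simp [Complex.norm_exp, abs_of_nonneg ht]
  ring

/-- Every linear system with constant coefficients has a solution through every point, which tends
to zero if all eigenvalues have negative real part. -/
theorem exists_complex_solution [DecidableEq ι] (M : Matrix ι ι ℂ) (v : ι → ℂ) :
    ∃ w : ℝ → ι → ℂ, w 0 = v ∧ (∀ t, HasDerivAt w (M *ᵥ w t) t) ∧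
      ((∀ z ∈ spectrum ℂ M, z.re < 0) → Tendsto w atTop (𝓝 0)) := by
  -- Generalized eigenspaces span, so by linearity `v` may be taken in one of them.
  have hv : v ∈ ⨆ z, Module.End.maxGenEigenspace (Matrix.toLin' M) z := by
    rw [Module.End.iSup_maxGenEigenspace_eq_top]; trivial
  induction hv using Submodule.iSup_induction' with
  | zero =>
    refine ⟨fun _ => 0, rfl, fun t => ?_, fun _ => tendsto_const_nhds⟩
    simpa using hasDerivAt_const t (0 : ι → ℂ)
  | add x y _ _ hx hy =>
    obtain ⟨w₁, h₁, d₁, l₁⟩ := hx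
    obtain ⟨w₂, h₂, d₂, l₂⟩ := hy
    refine ⟨fun t => w₁ t + w₂ t, by simp [h₁, h₂], fun t => ?_, fun h => ?_⟩
    · rw [mulVec_add]; exact (d₁ t).add (d₂ t)
    · simpa using (l₁ h).add (l₂ h)
  | mem z v hv =>
    obtain ⟨k, hk⟩ := (Module.End.mem_maxGenEigenspace _ _ _).1 hv
    set T := Matrix.toLin' M - z • (1 : Module.End ℂ (ι → ℂ)) with hT
    set u : ℕ → ι → ℂ := fun j => (T ^ j) v with hu
    have huk : u k = 0 := hk
    have hMu : ∀ j, M *ᵥ u j = z • u j + u (j + 1) := by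
      intro j
      have : u (j + 1) = T (u j) := by simp [hu, pow_succ']
      rw [this, hT]
      simp
    -- On a generalized eigenspace `e^{tM} v = e^{zt} ∑ t^j/j! (M - z)^j v` is a finite sum. Keeping
    -- the vanishing term `j = k` ensures that the term `j = 0` is present even for `k = 0`.
    refine ⟨fun t => Complex.exp (z * t) •
      ∑ j ∈ Finset.range (k + 1), ((t : ℂ) ^ j / (j.factorial : ℂ)) • u j, ?_, fun t => ?_,
      fun h => ?_⟩
    · simp [Finset.sum_range_succ', hu]
    · have he : HasDerivAt (fun t : ℝ => Complex.exp (z * t)) (Complex.exp (z * t) * z) t := by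
        have h0 : HasDerivAt (fun t : ℝ => z * (t : ℂ)) z t := by
          simpa using ((hasDerivAt_id t).ofReal_comp).const_mul z
        exact h0.cexp
      refine (he.smul (hasDerivAt_sum_pow_div_factorial_smul u k t)).congr_deriv ?_
      rw [mulVec_smul, mul_smul, ← smul_add]
      congr 1
      rw [Matrix.mulVec_sum]
      have hk1 : u (k + 1) = 0 := by
        have : u (k + 1) = T (u k) := by simp [hu, pow_succ']
        rw [this, huk, map_zero]
      have hshift : ∑ j ∈ Finset.range (k + 1), ((t : ℂ) ^ j / (j.factorial : ℂ)) • u (j + 1) =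
          ∑ j ∈ Finset.range k, ((t : ℂ) ^ j / (j.factorial : ℂ)) • u (j + 1) := by
        rw [Finset.sum_range_succ, hk1, smul_zero, add_zero]
      simp only [mulVec_smul, hMu, smul_add, Finset.sum_add_distrib, hshift, Finset.smul_sum]
      rw [add_comm]
      exact congrArg₂ _ (Finset.sum_congr rfl fun j _ => smul_comm _ _ _) rfl
    -- For `v = 0` the number `z` need not be an eigenvalue, so its real part is not controlled.
    · by_cases hv0 : v = 0
      · simp [hu, hv0]
      have hz : z ∈ spectrum ℂ M := by
        rw [← Matrix.spectrum_toLin', ← Module.End.hasEigenvalue_iff_mem_spectrum]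
        refine Module.End.hasEigenvalue_of_hasGenEigenvalue (k := k) ?_
        intro hbot
        refine hv0 ?_
        have : v ∈ Module.End.genEigenspace (Matrix.toLin' M) z k := by
          rw [Module.End.mem_genEigenspace_nat]; exact hk
        simpa [hbot] using this
      simp_rw [Finset.smul_sum, smul_smul]
      rw [show (0 : ι → ℂ) = ∑ j ∈ Finset.range (k + 1), (0 : ℂ) • u j by simp]
      exact tendsto_finsetSum _ fun j _ =>
        (tendsto_exp_mul_pow_div_factorial (h z hz) j).smul_const _

/-- As `M` is real, the real part of a complex solution is a solution. -/
theorem exists_real_solution [DecidableEq ι] (M : Matrix ι ι ℝ) (v : ι → ℝ) :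
    ∃ w : ℝ → ι → ℝ, w 0 = v ∧ (∀ t, HasDerivAt w (M *ᵥ w t) t) ∧
      (IsHurwitz M → Tendsto w atTop (𝓝 0)) := by
  obtain ⟨w, h0, hd, hl⟩ := exists_complex_solution (M.map (algebraMap ℝ ℂ)) (fun i => (v i : ℂ))
  refine ⟨fun t i => (w t i).re, ?_, fun t => ?_, fun h => ?_⟩
  · ext i; simp [h0]
  · rw [hasDerivAt_pi]
    intro i
    have h1 := Complex.reCLM.hasFDerivAt.comp_hasDerivAt t (hasDerivAt_pi.1 (hd t) i)
    refine h1.congr_deriv ?_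
    simp [mulVec, dotProduct]
  · have := hl h
    rw [tendsto_pi_nhds] at this ⊢
    intro i
    exact (Complex.continuous_re.tendsto _).comp (this i)

theorem linear_solution_unique (M : Matrix ι ι ℝ) {w₁ w₂ : ℝ → ι → ℝ}
    (h₁ : ∀ t, 0 ≤ t → HasDerivWithinAt w₁ (M *ᵥ w₁ t) (Set.Ici 0) t)
    (h₂ : ∀ t, 0 ≤ t → HasDerivWithinAt w₂ (M *ᵥ w₂ t) (Set.Ici 0) t)
    (h0 : w₁ 0 = w₂ 0) : Set.EqOn w₁ w₂ (Set.Ici 0) := by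
  intro T hT
  have hlip := (LinearMap.toContinuousLinearMap M.mulVecLin).lipschitz
  refine ODE_solution_unique_of_mem_Icc_right (a := 0) (b := T) (v := fun _ y => M *ᵥ y)
    (s := fun _ => Set.univ) (fun t _ => hlip.lipschitzOnWith)
    (fun t ht => ?_) (fun t ht => (h₁ t ht.1).mono fun s hs => ht.1.trans hs)
    (fun _ _ => Set.mem_univ _)
    (fun t ht => ?_) (fun t ht => (h₂ t ht.1).mono fun s hs => ht.1.trans hs)
    (fun _ _ => Set.mem_univ _) h0 (Set.right_mem_Icc.2 hT)
  · exact (h₁ t ht.1).continuousWithinAt.mono fun s hs => hs.1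
  · exact (h₂ t ht.1).continuousWithinAt.mono fun s hs => hs.1

/-- By uniqueness, any solution agrees on `[0, ∞)` with the explicit decaying one. -/
theorem IsHurwitz.tendsto_zero [DecidableEq ι] {M : Matrix ι ι ℝ} (hM : IsHurwitz M)
    {w : ℝ → ι → ℝ} (h : ∀ t, 0 ≤ t → HasDerivWithinAt w (M *ᵥ w t) (Set.Ici 0) t) :
    Tendsto w atTop (𝓝 0) := by
  obtain ⟨w', h0, hd, hl⟩ := exists_real_solution M (w 0)
  refine (hl hM).congr' ?_
  filter_upwards [eventually_ge_atTop 0] with t ht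
  exact linear_solution_unique M (fun t _ => (hd t).hasDerivWithinAt) h h0 ht

end LinearODE

/-! ### The follower block of the Laplacian. -/

namespace LeaderFollowerGraph

variable {n m : ℕ} (G : LeaderFollowerGraph n m)

theorem eigenvalue_eq_sum (i : Fin n) :
    G.eigenvalue i =
      ∑ j, G.weight (Sum.inl i) (Sum.inl j) + ∑ k, G.weight (Sum.inl i) (Sum.inr k) := by
  simp [eigenvalue, L₁, laplacian, Matrix.toBlocks₁₁]

/-- The last edge of a path from a leader to `i` contributes a positive weight to the row sum. -/
theorem eigenvalue_pos (hreach : G.EveryFollowerReached) (i : Fin n) : 0 < G.eigenvalue i := by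
  obtain ⟨k, hk⟩ := hreach i
  obtain ⟨w, _, hw⟩ := Relation.TransGen.tail'_iff.1 hk
  have h1 := Finset.sum_nonneg fun j (_ : j ∈ Finset.univ) =>
    G.weight_nonneg (Sum.inl i) (Sum.inl j)
  have h2 := Finset.sum_nonneg fun j (_ : j ∈ Finset.univ) =>
    G.weight_nonneg (Sum.inl i) (Sum.inr j)
  rw [eigenvalue_eq_sum]
  rcases w with j | l
  · exact add_pos_of_pos_of_nonneg (Finset.sum_pos' (fun j _ => G.weight_nonneg _ _)
      ⟨j, Finset.mem_univ _, hw⟩) h2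
  · exact add_pos_of_nonneg_of_pos h1 (Finset.sum_pos' (fun j _ => G.weight_nonneg _ _)
      ⟨l, Finset.mem_univ _, hw⟩)

theorem sum_L₁_smul {V : Type*} [AddCommGroup V] [Module ℝ V] (i : Fin n) (f : Fin n → V) :
    ∑ j, G.L₁ i j • f j = G.eigenvalue i • f i - ∑ j, G.weight (Sum.inl i) (Sum.inl j) • f j := by
  rw [← Finset.add_sum_erase _ _ (Finset.mem_univ i),
    ← Finset.add_sum_erase (f := fun j => G.weight (Sum.inl i) (Sum.inl j) • f j) _
      (Finset.mem_univ i), G.no_self_loop, zero_smul, zero_add, sub_eq_add_neg,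
    ← Finset.sum_neg_distrib]
  refine congrArg₂ _ rfl (Finset.sum_congr rfl fun j hj => ?_)
  have hij : i ≠ j := (Finset.ne_of_mem_erase hj).symm
  simp [L₁, laplacian, Matrix.toBlocks₁₁, hij]

/-- Links `L₁` to the relative differences in the protocol and in the containment error. -/
theorem sum_L₁_smul_eq_relative {V : Type*} [AddCommGroup V] [Module ℝ V] (i : Fin n)
    (f : Fin n → V) :
    ∑ j, G.L₁ i j • f j = ∑ j, G.weight (Sum.inl i) (Sum.inl j) • (f i - f j) +
      ∑ k : Fin m, G.weight (Sum.inl i) (Sum.inr k) • f i := by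
  rw [sum_L₁_smul, eigenvalue_eq_sum]
  simp only [smul_sub, Finset.sum_sub_distrib, add_smul, Finset.sum_smul]
  abel

/-- Followers of an acyclic graph can be treated after all their neighbours. -/
theorem follower_induction (hG : G.Acyclic) {Q : Fin n → Prop}
    (h : ∀ i, (∀ j, G.weight (Sum.inl i) (Sum.inl j) ≠ 0 → Q j) → Q i) (i : Fin n) : Q i := by
  have hirr : Std.Irrefl (Relation.TransGen fun j i : Fin n => G.Edge (Sum.inl j) (Sum.inl i)) :=
    ⟨fun i hi => hG (Sum.inl i)
      (Relation.TransGen.lift (p := G.Edge) Sum.inl (fun _ _ h => h) _ _ hi)⟩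
  have hwf : WellFounded (Relation.TransGen fun j i : Fin n => G.Edge (Sum.inl j) (Sum.inl i)) :=
    Finite.wellFounded_of_trans_of_irrefl _
  induction i using hwf.induction with
  | _ i ih =>
    exact h i fun j hj => ih j (Relation.TransGen.single
      (lt_of_le_of_ne (G.weight_nonneg _ _) hj.symm))

/-- The decoupling used inside `follower_induction`: only the diagonal entry of row `i` survives. -/
theorem sum_L₁_smul_of_neighbors_eq_zero {V : Type*} [AddCommGroup V] [Module ℝ V] {i : Fin n}
    {f : Fin n → V} (h : ∀ j, G.weight (Sum.inl i) (Sum.inl j) ≠ 0 → f j = 0) :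
    ∑ j, G.L₁ i j • f j = G.eigenvalue i • f i := by
  rw [sum_L₁_smul, Finset.sum_eq_zero, sub_zero]
  intro j _
  by_cases hj : G.weight (Sum.inl i) (Sum.inl j) = 0
  · rw [hj, zero_smul]
  · rw [h j hj, smul_zero]

/-- The matrix `W` solves `L₁ W = (a_ik)`, where `a_ik` are the follower-leader weights. -/
theorem exists_containment_weights (hG : G.Acyclic) (hreach : G.EveryFollowerReached) :
    ∃ W : Matrix (Fin n) (Fin m) ℝ, ∀ i k, ∑ j, G.L₁ i j * W j k =
      G.weight (Sum.inl i) (Sum.inr k) := by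
  -- Up to sign, the determinant is the constant coefficient of `∏ (X - λ_i)`, and every `λ_i` is
  -- positive.
  have hdet : IsUnit G.L₁.det := by
    rw [isUnit_iff_ne_zero, Matrix.det_eq_sign_charpoly_coeff, G.charpoly_L₁ hG,
      Polynomial.coeff_zero_eq_eval_zero, Polynomial.eval_prod]
    refine mul_ne_zero (pow_ne_zero _ (by norm_num)) (Finset.prod_ne_zero_iff.2 fun i _ => ?_)
    simpa using (G.eigenvalue_pos hreach i).ne'
  refine ⟨G.L₁⁻¹ * Matrix.of fun i k => G.weight (Sum.inl i) (Sum.inr k), fun i k => ?_⟩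
  rw [← Matrix.mul_apply, Matrix.mul_nonsing_inv_cancel_left _ _ hdet, Matrix.of_apply]

end LeaderFollowerGraph

/-! ### The closed-loop matrix, read agent by agent. -/

namespace ContainmentControl

variable {n m : ℕ} {N p : Fin n → ℕ} {q r : ℕ}
variable (G : LeaderFollowerGraph n m) (P : AgentDynamics N p q r) (g : ProtocolGains N p q r)

/-- The stacked state of the closed loop. -/
def packState (x ξ : ∀ i, Fin (N i) → ℝ) (η : Fin n → Fin r → ℝ) :
    (Σ i, Fin (N i)) ⊕ ((Σ i, Fin (N i)) ⊕ (Fin n × Fin r)) → ℝ :=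
  Sum.elim (fun s => x s.1 s.2) (Sum.elim (fun s => ξ s.1 s.2) fun s => η s.1 s.2)

theorem exists_packState (z : (Σ i, Fin (N i)) ⊕ ((Σ i, Fin (N i)) ⊕ (Fin n × Fin r)) → ℝ) :
    ∃ x ξ η, packState x ξ η = z :=
  ⟨fun i a => z (Sum.inl ⟨i, a⟩), fun i a => z (Sum.inr (Sum.inl ⟨i, a⟩)),
    fun i a => z (Sum.inr (Sum.inr (i, a))), by ext (s | s | s) <;> rfl⟩

theorem packState_inj {x x' ξ ξ' : ∀ i, Fin (N i) → ℝ} {η η' : Fin n → Fin r → ℝ} :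
    packState x ξ η = packState x' ξ' η' ↔
      (∀ i, x i = x' i) ∧ (∀ i, ξ i = ξ' i) ∧ ∀ i, η i = η' i := by
  refine ⟨fun h => ⟨fun i => funext fun a => ?_, fun i => funext fun a => ?_,
    fun i => funext fun a => ?_⟩, fun ⟨h1, h2, h3⟩ => ?_⟩
  · exact congrFun h (Sum.inl ⟨i, a⟩)
  · exact congrFun h (Sum.inr (Sum.inl ⟨i, a⟩))
  · exact congrFun h (Sum.inr (Sum.inr (i, a)))
  · rw [funext h1, funext h2, funext h3]

theorem blockDiagonal'_mulVec_sigma {a b : Fin n → ℕ} (X : ∀ i, Matrix (Fin (a i)) (Fin (b i)) ℝ)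
    (v : ∀ i, Fin (b i) → ℝ) :
    (blockDiagonal' X *ᵥ fun s => v s.1 s.2) = fun s => (X s.1 *ᵥ v s.1) s.2 := by
  ext ⟨i, c⟩
  simp only [mulVec, dotProduct, Fintype.sum_sigma]
  rw [Finset.sum_eq_single i]
  · simp [blockDiagonal'_apply_eq]
  · intro j _ hj
    exact Finset.sum_eq_zero fun d _ => by rw [blockDiagonal'_apply_ne _ _ _ hj.symm, zero_mul]
  · simp

theorem Cbar_mulVec (v : ∀ i, Fin (N i) → ℝ) :
    (Cbar P *ᵥ fun s => v s.1 s.2) = fun s => (P.C s.1 *ᵥ v s.1) s.2 := by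
  have h := blockDiagonal'_mulVec_sigma (a := fun _ => q) P.C v
  ext ⟨i, c⟩
  exact congrFun h ⟨i, c⟩

theorem blockDiagonal'_submatrix_mulVec {a : Fin n → ℕ} {d : ℕ}
    (X : ∀ i, Matrix (Fin (a i)) (Fin d) ℝ) (v : Fin n → Fin d → ℝ) :
    (((blockDiagonal' X).submatrix id (stack n d).symm) *ᵥ fun s => v s.1 s.2) =
      fun s => (X s.1 *ᵥ v s.1) s.2 := by
  rw [← blockDiagonal'_mulVec_sigma X (fun i => v i), submatrix_mulVec_equiv]
  rfl

open scoped Kronecker in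
theorem kronecker_one_mulVec {d : ℕ} (L : Matrix (Fin n) (Fin n) ℝ) (v : Fin n → Fin d → ℝ) :
    ((L ⊗ₖ (1 : Matrix (Fin d) (Fin d) ℝ)) *ᵥ fun s => v s.1 s.2) =
      fun s => (∑ j, L s.1 j • v j) s.2 := by
  ext ⟨i, c⟩
  simp [mulVec, dotProduct, Fintype.sum_prod_type, one_apply]

open scoped Kronecker in
theorem one_kronecker_mulVec {d : ℕ} (S : Matrix (Fin d) (Fin d) ℝ) (v : Fin n → Fin d → ℝ) :
    (((1 : Matrix (Fin n) (Fin n) ℝ) ⊗ₖ S) *ᵥ fun s => v s.1 s.2) =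
      fun s => (S *ᵥ v s.1) s.2 := by
  ext ⟨i, c⟩
  simp only [mulVec, dotProduct, Fintype.sum_prod_type, kroneckerMap_apply, one_apply]
  rw [Finset.sum_eq_single i]
  · simp
  · intro j _ hj
    simp [hj.symm]
  · simp

theorem observerCoupling_mulVec (v : ∀ i, Fin (N i) → ℝ) :
    (observerCoupling G P g *ᵥ fun s => v s.1 s.2) =
      fun s => (g.μ s.1 • g.F s.1 *ᵥ ∑ j, G.L₁ s.1 j • P.C j *ᵥ v j) s.2 := by
  rw [observerCoupling, ← mulVec_mulVec, Cbar_mulVec, ← mulVec_mulVec,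
    kronecker_one_mulVec _ fun i => P.C i *ᵥ v i, ← mulVec_mulVec, Fbar,
    blockDiagonal'_submatrix_mulVec g.F fun i => ∑ j, G.L₁ i j • P.C j *ᵥ v j]
  ext s
  simp [μbar, mulVec_diagonal]

/-- The blocks `M` and `-M` of the second row combine, so the observer coupling sees only `x - ξ`.
-/
theorem closedLoopMatrix_mulVec (x ξ : ∀ i, Fin (N i) → ℝ) (η : Fin n → Fin r → ℝ) :
    closedLoopMatrix G P g *ᵥ packState x ξ η = packState
      (fun i => P.A i *ᵥ x i + P.B i *ᵥ control g i (ξ i) (η i))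
      (fun i => P.A i *ᵥ ξ i + P.B i *ᵥ control g i (ξ i) (η i) +
        g.μ i • g.F i *ᵥ ∑ j, G.L₁ i j • P.C j *ᵥ (x j - ξ j))
      (fun i => P.S *ᵥ η i - g.β • ∑ j, G.L₁ i j • η j) := by
  have hA : ∀ v : ∀ i, Fin (N i) → ℝ, (Abar P *ᵥ fun s => v s.1 s.2) =
      fun s => (P.A s.1 *ᵥ v s.1) s.2 := blockDiagonal'_mulVec_sigma P.A
  have hB1 : ((Bbar P * K₁bar g) *ᵥ fun s => ξ s.1 s.2) =
      fun s => (P.B s.1 *ᵥ g.K₁ s.1 *ᵥ ξ s.1) s.2 := by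
    rw [← mulVec_mulVec, K₁bar, blockDiagonal'_mulVec_sigma, Bbar,
      blockDiagonal'_mulVec_sigma P.B fun i => g.K₁ i *ᵥ ξ i]
  have hB2 : ((Bbar P * K₂bar g) *ᵥ fun s => η s.1 s.2) =
      fun s => (P.B s.1 *ᵥ g.K₂ s.1 *ᵥ η s.1) s.2 := by
    rw [← mulVec_mulVec, K₂bar, blockDiagonal'_submatrix_mulVec, Bbar,
      blockDiagonal'_mulVec_sigma P.B fun i => g.K₂ i *ᵥ η i]
  rw [closedLoopMatrix, packState, fromBlocks_mulVec, fromCols_mulVec, fromRows_mulVec,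
    fromBlocks_mulVec]
  simp only [Function.comp_def, Sum.elim_inl, Sum.elim_inr]
  simp only [sub_mulVec, add_mulVec, kronecker_smul, smul_mulVec, hA, hB1, hB2,
    kronecker_one_mulVec, one_kronecker_mulVec, observerCoupling_mulVec, zero_mulVec]
  ext (⟨i, a⟩ | ⟨i, a⟩ | ⟨i, a⟩)
  · simp [packState, control, mulVec_add, add_assoc]
  · simp only [packState, control, mulVec_add, mulVec_sub, smul_sub, Finset.sum_sub_distrib,
      Sum.elim_inl, Sum.elim_inr, Pi.add_apply, Pi.sub_apply]
    ring
  · simp [packState]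

end ContainmentControl

/-! ### Stability of the closed loop. -/

namespace ContainmentControl

variable {n m : ℕ} {N p : Fin n → ℕ} {q r : ℕ}
variable (G : LeaderFollowerGraph n m) (P : AgentDynamics N p q r) (g : ProtocolGains N p q r)

/-- Take `Φ` itself as Lyapunov matrix. The Riccati equation turns the Lyapunov expression into `-(E
+ (2c - 1) Φ Cᵀ R⁻¹ C Φ)`, negative definite as soon as `c ≥ 1/2`. -/
theorem isHurwitz_observerBlock {N q : ℕ} {A E Φ : Matrix (Fin N) (Fin N) ℝ}
    {C : Matrix (Fin q) (Fin N) ℝ} {R : Matrix (Fin q) (Fin q) ℝ} (hE : E.PosDef)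
    (hR : R.PosDef) (hΦ : Φ.PosDef)
    (hARE : A * Φ + Φ * Aᵀ + E - Φ * Cᵀ * R⁻¹ * C * Φ = 0) {c : ℝ} (hc : 1 / 2 ≤ c) :
    IsHurwitz (A - c • (Φ * Cᵀ * R⁻¹ * C)) := by
  have hΦs : Φᵀ = Φ := by simpa using hΦ.isHermitian.eq
  have hRs : (R⁻¹)ᵀ = R⁻¹ := by simpa using hR.inv.isHermitian.eq
  have hpsd : (Φ * Cᵀ * R⁻¹ * C * Φ).PosSemidef := by
    have h := hR.inv.posSemidef.conjTranspose_mul_mul_same (C * Φ)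
    simpa [conjTranspose_eq_transpose_of_trivial, hΦs, Matrix.mul_assoc] using h
  refine IsHurwitz.of_lyapunov hΦ (hE.add_posSemidef (hpsd.smul (a := 2 * c - 1) (by linarith))) ?_
  have h1 : A * Φ + Φ * Aᵀ = Φ * Cᵀ * R⁻¹ * C * Φ - E := by
    rw [eq_sub_iff_add_eq, ← sub_eq_zero]; exact hARE
  have h2 : (Φ * Cᵀ * R⁻¹ * C)ᵀ = Cᵀ * R⁻¹ * C * Φ := by
    simp [transpose_mul, hΦs, hRs, Matrix.mul_assoc]
  have h3 : Φ * (Cᵀ * R⁻¹ * C * Φ) = Φ * Cᵀ * R⁻¹ * C * Φ := by simp only [Matrix.mul_assoc]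
  rw [transpose_sub, transpose_smul, h2, Matrix.sub_mul, Matrix.mul_sub, Matrix.smul_mul,
    Matrix.mul_smul, h3, sub_add_sub_comm, h1]
  module

theorem isHurwitz_closedLoopMatrix (hG : G.Acyclic) (hreach : G.EveryFollowerReached)
    (hS : ∀ z ∈ spectrum ℂ (P.S.map (algebraMap ℝ ℂ)), z.re ≤ 0) (hbeta : 0 < g.β)
    (hobs : ∀ i, IsHurwitz (P.A i - (g.μ i * G.eigenvalue i) • (g.F i * P.C i)))
    (hK₁ : ∀ i, IsHurwitz (P.A i + P.B i * g.K₁ i)) :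
    IsHurwitz (closedLoopMatrix G P g) := by
  intro z hz
  by_contra! hre
  obtain ⟨a, b, hab, ha, hb⟩ := exists_realPair_of_mem_spectrum hz
  obtain ⟨x, ξ, η, rfl⟩ := exists_packState a
  obtain ⟨x', ξ', η', rfl⟩ := exists_packState b
  have hsub : z.re • packState x ξ η - z.im • packState x' ξ' η' = packState
      (fun i => z.re • x i - z.im • x' i) (fun i => z.re • ξ i - z.im • ξ' i)
      (fun i => z.re • η i - z.im • η' i) := by ext (s | s | s) <;> rfl
  have hadd : z.re • packState x' ξ' η' + z.im • packState x ξ η = packState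
      (fun i => z.re • x' i + z.im • x i) (fun i => z.re • ξ' i + z.im • ξ i)
      (fun i => z.re • η' i + z.im • η i) := by ext (s | s | s) <;> rfl
  rw [closedLoopMatrix_mulVec, hsub, packState_inj] at ha
  rw [closedLoopMatrix_mulVec, hadd, packState_inj] at hb
  obtain ⟨hx, hξ, hη⟩ := ha
  obtain ⟨hx', hξ', hη'⟩ := hb
  have hη0 : ∀ i, η i = 0 ∧ η' i = 0 := by
    refine G.follower_induction hG fun i ih => ?_
    have h := hη i
    have h' := hη' i
    rw [G.sum_L₁_smul_of_neighbors_eq_zero fun j hj => (ih j hj).1, sub_eq_iff_eq_add] at h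
    rw [G.sum_L₁_smul_of_neighbors_eq_zero fun j hj => (ih j hj).2, sub_eq_iff_eq_add] at h'
    have hpos := mul_pos hbeta (G.eigenvalue_pos hreach i)
    -- Moving the diagonal Laplacian term across shifts the eigenvalue to `z + β λ_i`, whose real
    -- part is positive.
    refine realPair_eq_zero (M := P.S) (z := ⟨z.re + g.β * G.eigenvalue i, z.im⟩)
      (fun hmem => ?_) ?_ ?_
    · have := hS _ hmem
      simp only at this
      linarith
    · rw [h]; module
    · rw [h']; module
  have hδ0 : ∀ i, x i - ξ i = 0 ∧ x' i - ξ' i = 0 := by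
    refine G.follower_induction hG fun i ih => ?_
    have h := hξ i
    have h' := hξ' i
    rw [G.sum_L₁_smul_of_neighbors_eq_zero (fun j hj => by rw [(ih j hj).1, mulVec_zero])] at h
    rw [G.sum_L₁_smul_of_neighbors_eq_zero (fun j hj => by rw [(ih j hj).2, mulVec_zero])] at h'
    refine realPair_eq_zero (fun hmem => (hobs i z hmem).not_ge hre) ?_ ?_
    -- The plant and its observer receive the same input, which cancels in the difference.
    · have h0 := congrArg₂ (· - ·) (hx i) h
      rw [sub_mulVec, smul_mulVec, ← mulVec_mulVec, mul_smul]
      simp only [mulVec_sub, mulVec_smul, smul_sub] at h0 ⊢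
      linear_combination (exp := 1) h0
    · have h0 := congrArg₂ (· - ·) (hx' i) h'
      rw [sub_mulVec, smul_mulVec, ← mulVec_mulVec, mul_smul]
      simp only [mulVec_sub, mulVec_smul, smul_sub] at h0 ⊢
      linear_combination (exp := 1) h0
  have hx0 : ∀ i, x i = 0 ∧ x' i = 0 := by
    intro i
    have h := hx i
    have h' := hx' i
    -- With `η = 0` and `ξ = x` the protocol is the state feedback `K_i¹ x_i`.
    rw [control, (hη0 i).1, ← sub_eq_zero.1 (hδ0 i).1] at h
    rw [control, (hη0 i).2, ← sub_eq_zero.1 (hδ0 i).2] at h'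
    refine realPair_eq_zero (fun hmem => (hK₁ i z hmem).not_ge hre) ?_ ?_
    · rw [add_mulVec, ← mulVec_mulVec, ← h, mulVec_zero, add_zero]
    · rw [add_mulVec, ← mulVec_mulVec, ← h', mulVec_zero, add_zero]
  have hzero : packState (N := N) (r := r) (fun _ => 0) (fun _ => 0) (fun _ => 0) = 0 := by
    ext (s | s | s) <;> rfl
  refine hab.elim (fun h => h ?_) (fun h => h ?_)
  · rw [← hzero, packState_inj]
    exact ⟨fun i => (hx0 i).1, fun i => by rw [← sub_eq_zero.1 (hδ0 i).1, (hx0 i).1],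
      fun i => (hη0 i).1⟩
  · rw [← hzero, packState_inj]
    exact ⟨fun i => (hx0 i).2, fun i => by rw [← sub_eq_zero.1 (hδ0 i).2, (hx0 i).2],
      fun i => (hη0 i).2⟩

/-! ### The steady state and the deviation from it. -/

/-- The linear combination of leader states with the weights in row `i` of `W`. -/
def target (W : Matrix (Fin n) (Fin m) ℝ) (ω : Fin m → Fin r → ℝ) (i : Fin n) : Fin r → ℝ :=
  ∑ k, W i k • ω k

/-- The stacked deviation of the closed loop from its steady state. -/
def deviation (Pi : ∀ i, Matrix (Fin (N i)) (Fin r) ℝ) (W : Matrix (Fin n) (Fin m) ℝ)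
    (x ξ : ∀ i, Fin (N i) → ℝ) (η : Fin n → Fin r → ℝ) (ω : Fin m → Fin r → ℝ) :
    (Σ i, Fin (N i)) ⊕ ((Σ i, Fin (N i)) ⊕ (Fin n × Fin r)) → ℝ :=
  packState (fun i => x i - Pi i *ᵥ target W ω i) (fun i => ξ i - Pi i *ᵥ target W ω i)
    (fun i => η i - target W ω i)

theorem sum_L₁_smul_target {G : LeaderFollowerGraph n m} {W : Matrix (Fin n) (Fin m) ℝ}
    (hW : ∀ i k, ∑ j, G.L₁ i j * W j k = G.weight (Sum.inl i) (Sum.inr k))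
    (ω : Fin m → Fin r → ℝ) (i : Fin n) :
    ∑ j, G.L₁ i j • target W ω j = ∑ k, G.weight (Sum.inl i) (Sum.inr k) • ω k := by
  simp only [target, Finset.smul_sum, smul_smul]
  rw [Finset.sum_comm]
  simp only [← Finset.sum_smul, hW]

/-- The leader outputs cancel, so only estimation errors remain. -/
theorem observerSignal_eq (x ξ : ∀ i, Fin (N i) → ℝ) (ω : Fin m → Fin r → ℝ) (i : Fin n) :
    observerSignal G P x ξ ω i = -∑ j, G.L₁ i j • P.C j *ᵥ (x j - ξ j) := by
  rw [G.sum_L₁_smul_eq_relative i fun j => P.C j *ᵥ (x j - ξ j), observerSignal, neg_add,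
    ← Finset.sum_neg_distrib, ← Finset.sum_neg_distrib]
  refine congrArg₂ _ (Finset.sum_congr rfl fun j _ => ?_) (Finset.sum_congr rfl fun k _ => ?_)
  · rw [← smul_neg, mulVec_sub, mulVec_sub]; congr 1; abel
  · rw [← smul_neg, mulVec_sub]; congr 1; abel

/-- The leader part of the error is `L₁` applied to the outputs `D w_j`, by the choice of `W`, and
`D w_j = C_j Π_j w_j`. -/
theorem containmentError_eq {G : LeaderFollowerGraph n m} {P : AgentDynamics N p q r}
    {Pi : ∀ i, Matrix (Fin (N i)) (Fin r) ℝ} (hreg_output : ∀ i, P.D = P.C i * Pi i)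
    {W : Matrix (Fin n) (Fin m) ℝ}
    (hW : ∀ i k, ∑ j, G.L₁ i j * W j k = G.weight (Sum.inl i) (Sum.inr k))
    (x : ∀ i, Fin (N i) → ℝ) (ω : Fin m → Fin r → ℝ) (i : Fin n) :
    containmentError G P x ω i = ∑ j, G.L₁ i j • P.C j *ᵥ (x j - Pi j *ᵥ target W ω j) := by
  have h1 : ∀ j, P.C j *ᵥ (x j - Pi j *ᵥ target W ω j) =
      P.C j *ᵥ x j - P.D *ᵥ target W ω j := fun j => by
    rw [mulVec_sub, mulVec_mulVec, ← hreg_output]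
  have h2 : ∑ j, G.L₁ i j • P.D *ᵥ target W ω j =
      ∑ k, G.weight (Sum.inl i) (Sum.inr k) • P.D *ᵥ ω k := by
    simp only [← mulVec_smul, ← mulVec_sum, sum_L₁_smul_target hW]
  simp only [h1, smul_sub, Finset.sum_sub_distrib, h2]
  rw [G.sum_L₁_smul_eq_relative i fun j => P.C j *ᵥ x j, containmentError]
  simp only [smul_sub, Finset.sum_sub_distrib]
  abel

theorem hasDerivWithinAt_packState {x ξ : ℝ → ∀ i, Fin (N i) → ℝ} {η : ℝ → Fin n → Fin r → ℝ}
    {x' ξ' : ∀ i, Fin (N i) → ℝ} {η' : Fin n → Fin r → ℝ} {s : Set ℝ} {t : ℝ} :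
    HasDerivWithinAt (fun t => packState (x t) (ξ t) (η t)) (packState x' ξ' η') s t ↔
      (∀ i, HasDerivWithinAt (fun t => x t i) (x' i) s t) ∧
      (∀ i, HasDerivWithinAt (fun t => ξ t i) (ξ' i) s t) ∧
      ∀ i, HasDerivWithinAt (fun t => η t i) (η' i) s t := by
  simp only [hasDerivWithinAt_pi, Sum.forall, Sigma.forall, Prod.forall]
  rfl

theorem hasDerivWithinAt_sub_iff {V : Type*} [NormedAddCommGroup V] [NormedSpace ℝ V]
    {f h : ℝ → V} {f' h' d : V} {s : Set ℝ} {t : ℝ} (hh : HasDerivWithinAt h h' s t)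
    (hd : d = f' - h') :
    HasDerivWithinAt (fun t => f t - h t) d s t ↔ HasDerivWithinAt f f' s t := by
  subst hd
  refine ⟨fun hfh => ?_, fun hf => hf.sub hh⟩
  simpa using HasDerivWithinAt.fun_add hfh hh

/-- Subtracting the steady state removes the leaders from the dynamics. The forward direction gives
convergence, the backward one existence. -/
theorem isTrajectory_iff {G : LeaderFollowerGraph n m} {P : AgentDynamics N p q r}
    {g : ProtocolGains N p q r} {Pi : ∀ i, Matrix (Fin (N i)) (Fin r) ℝ}
    {Gam : ∀ i, Matrix (Fin (p i)) (Fin r) ℝ}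
    (hreg_state : ∀ i, Pi i * P.S = P.A i * Pi i + P.B i * Gam i)
    (hK₂ : ∀ i, g.K₂ i = Gam i - g.K₁ i * Pi i)
    {W : Matrix (Fin n) (Fin m) ℝ}
    (hW : ∀ i k, ∑ j, G.L₁ i j * W j k = G.weight (Sum.inl i) (Sum.inr k))
    {x ξ : ℝ → ∀ i, Fin (N i) → ℝ} {η : ℝ → Fin n → Fin r → ℝ} {ω : ℝ → Fin m → Fin r → ℝ}
    (hω : ∀ k, ∀ t, 0 ≤ t →
      HasDerivWithinAt (fun s => ω s k) (P.S *ᵥ ω t k) (Set.Ici 0) t) :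
    IsTrajectory G P g x ξ η ω ↔ ∀ t, 0 ≤ t →
      HasDerivWithinAt (fun t => deviation Pi W (x t) (ξ t) (η t) (ω t))
        (closedLoopMatrix G P g *ᵥ deviation Pi W (x t) (ξ t) (η t) (ω t)) (Set.Ici 0) t := by
  have htarget : ∀ i, ∀ t, 0 ≤ t → HasDerivWithinAt (fun s => target W (ω s) i)
      (P.S *ᵥ target W (ω t) i) (Set.Ici 0) t := by
    intro i t ht
    simp only [target, mulVec_sum, mulVec_smul]
    exact HasDerivWithinAt.fun_sum fun k _ => (hω k t ht).const_smul (W i k)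
  have hPi : ∀ i, ∀ t, 0 ≤ t → HasDerivWithinAt (fun s => Pi i *ᵥ target W (ω s) i)
      (Pi i *ᵥ P.S *ᵥ target W (ω t) i) (Set.Ici 0) t := fun i t ht =>
    (LinearMap.toContinuousLinearMap (Pi i).mulVecLin).hasFDerivAt.comp_hasDerivWithinAt t
      (htarget i t ht)
  -- The choice `K_i² = Γ_i - K_i¹ Π_i` makes `Γ_i w` the input at the steady state.
  have hcontrol : ∀ i (y : Fin (N i) → ℝ) (v w : Fin r → ℝ),
      control g i (y - Pi i *ᵥ w) (v - w) = control g i y v - Gam i *ᵥ w := by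
    intro i y v w
    simp only [control, hK₂, mulVec_sub, sub_mulVec, mulVec_mulVec]
    abel
  have hsteady : ∀ i (w : Fin r → ℝ),
      Pi i *ᵥ P.S *ᵥ w = P.A i *ᵥ Pi i *ᵥ w + P.B i *ᵥ Gam i *ᵥ w := by
    intro i w
    simp only [mulVec_mulVec, hreg_state, add_mulVec]
  have key : ∀ t, 0 ≤ t →
      (HasDerivWithinAt (fun t => deviation Pi W (x t) (ξ t) (η t) (ω t))
        (closedLoopMatrix G P g *ᵥ deviation Pi W (x t) (ξ t) (η t) (ω t)) (Set.Ici 0) t ↔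
      (∀ i, HasDerivWithinAt (fun s => x s i)
        (P.A i *ᵥ x t i + P.B i *ᵥ control g i (ξ t i) (η t i)) (Set.Ici 0) t) ∧
      (∀ i, HasDerivWithinAt (fun s => ξ s i)
        (P.A i *ᵥ ξ t i + P.B i *ᵥ control g i (ξ t i) (η t i)
          - g.μ i • g.F i *ᵥ observerSignal G P (x t) (ξ t) (ω t) i) (Set.Ici 0) t) ∧
      ∀ i, HasDerivWithinAt (fun s => η s i)
        (P.S *ᵥ η t i + g.β •
          (∑ j : Fin n, G.weight (Sum.inl i) (Sum.inl j) • (η t j - η t i) +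
            ∑ k : Fin m, G.weight (Sum.inl i) (Sum.inr k) • (ω t k - η t i)))
        (Set.Ici 0) t) := by
    intro t ht
    simp only [deviation]
    rw [closedLoopMatrix_mulVec, hasDerivWithinAt_packState]
    refine and_congr (forall_congr' fun i => hasDerivWithinAt_sub_iff (hPi i t ht) ?_)
      (and_congr (forall_congr' fun i => hasDerivWithinAt_sub_iff (hPi i t ht) ?_)
        (forall_congr' fun i => hasDerivWithinAt_sub_iff (htarget i t ht) ?_))
    · rw [hcontrol, hsteady, mulVec_sub, mulVec_sub]
      abel
    · rw [hcontrol, hsteady, observerSignal_eq]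
      simp only [sub_sub_sub_cancel_right]
      rw [mulVec_sub, mulVec_sub, mulVec_neg, smul_neg]
      abel
    · simp only [smul_sub, Finset.sum_sub_distrib, mulVec_sub]
      rw [sum_L₁_smul_target hW, G.sum_L₁_smul_eq_relative]
      simp only [smul_sub, Finset.sum_sub_distrib, smul_add]
      abel
  refine ⟨fun h t ht => (key t ht).2 ⟨fun i => h.follower i t ht,
    fun i => h.stateObserver i t ht, fun i => h.leaderObserver i t ht⟩, fun h => ?_⟩
  exact ⟨fun i t ht => ((key t ht).1 (h t ht)).1 i, fun i t ht => ((key t ht).1 (h t ht)).2.1 i,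
    fun i t ht => ((key t ht).1 (h t ht)).2.2 i, hω⟩

theorem solvesCooperativeOutputRegulation_of_isHurwitz
    {G : LeaderFollowerGraph n m} (hG : G.Acyclic) (hreach : G.EveryFollowerReached)
    {P : AgentDynamics N p q r} {g : ProtocolGains N p q r}
    {Pi : ∀ i, Matrix (Fin (N i)) (Fin r) ℝ} {Gam : ∀ i, Matrix (Fin (p i)) (Fin r) ℝ}
    (hreg_state : ∀ i, Pi i * P.S = P.A i * Pi i + P.B i * Gam i)
    (hreg_output : ∀ i, P.D = P.C i * Pi i)
    (hK₂ : ∀ i, g.K₂ i = Gam i - g.K₁ i * Pi i)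
    (hH : IsHurwitz (closedLoopMatrix G P g)) :
    SolvesCooperativeOutputRegulation G P g := by
  obtain ⟨W, hW⟩ := G.exists_containment_weights hG hreach
  refine ⟨hH, fun x₀ ξ₀ η₀ ω₀ => ⟨?_, fun x ξ η ω htraj _ _ _ _ => ?_⟩⟩
  -- The leaders are autonomous: solve for `ω`, then for the deviation, and add the steady state
  -- back.
  · choose ω hω0 hωd _ using fun k => exists_real_solution P.S (ω₀ k)
    obtain ⟨z, hz0, hzd, _⟩ := exists_real_solution (closedLoopMatrix G P g)
      (deviation Pi W x₀ ξ₀ η₀ ω₀)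
    choose x ξ η hpack using fun t => exists_packState (z t)
    refine ⟨fun t i => x t i + Pi i *ᵥ target W (fun k => ω k t) i,
      fun t i => ξ t i + Pi i *ᵥ target W (fun k => ω k t) i,
      fun t i => η t i + target W (fun k => ω k t) i, fun t k => ω k t, ?_, ?_⟩
    · rw [isTrajectory_iff hreg_state hK₂ hW fun k t _ => (hωd k t).hasDerivWithinAt]
      intro t _
      simp only [deviation, add_sub_cancel_right]
      have : (fun t => packState (x t) (ξ t) (η t)) = z := funext hpack
      simpa only [this, hpack] using (hzd t).hasDerivWithinAt
    · rw [← hpack 0, deviation, packState_inj] at hz0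
      obtain ⟨h1, h2, h3⟩ := hz0
      have hω0' : (fun k => ω k 0) = ω₀ := funext hω0
      refine ⟨funext fun i => ?_, funext fun i => ?_, funext fun i => ?_, hω0'⟩ <;> beta_reduce
      · rw [h1, hω0', sub_add_cancel]
      · rw [h2, hω0', sub_add_cancel]
      · rw [h3, hω0', sub_add_cancel]
  · have hdev := hH.tendsto_zero
      ((isTrajectory_iff hreg_state hK₂ hW htraj.leader).1 htraj)
    rw [tendsto_pi_nhds]
    intro i
    have hx : ∀ j, Tendsto (fun t => x t j - Pi j *ᵥ target W (ω t) j) atTop (𝓝 0) := fun j =>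
      tendsto_pi_nhds.2 fun a => tendsto_pi_nhds.1 hdev (Sum.inl ⟨j, a⟩)
    simp only [containmentError_eq hreg_output hW]
    have h0 : (0 : Fin q → ℝ) = ∑ j, G.L₁ i j • P.C j *ᵥ (0 : Fin (N j) → ℝ) := by simp
    rw [show (0 : Fin n → Fin q → ℝ) i = 0 from rfl, h0]
    exact tendsto_finsetSum _ fun j _ =>
      ((((P.C j).mulVecLin.continuous_of_finiteDimensional).tendsto 0).comp (hx j)).const_smul _

end ContainmentControl

theorem theorem1 {n m q r : ℕ} {N p : Fin n → ℕ}
    (G : LeaderFollowerGraph n m) (hacyclic : G.Acyclic) (hreach : G.EveryFollowerReached)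
    (P : AgentDynamics N p q r) (hS : IsMarginallyStable P.S)
    (Pi : ∀ i, Matrix (Fin (N i)) (Fin r) ℝ) (Gam : ∀ i, Matrix (Fin (p i)) (Fin r) ℝ)
    (hreg_state : ∀ i, Pi i * P.S = P.A i * Pi i + P.B i * Gam i)
    (hreg_output : ∀ i, P.D = P.C i * Pi i)
    (E Phi : ∀ i, Matrix (Fin (N i)) (Fin (N i)) ℝ) (R : Fin n → Matrix (Fin q) (Fin q) ℝ)
    (hE : ∀ i, (E i).PosDef) (hR : ∀ i, (R i).PosDef) (hPhi : ∀ i, (Phi i).PosDef)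
    (hARE : ∀ i, P.A i * Phi i + Phi i * (P.A i)ᵀ + E i
      - Phi i * (P.C i)ᵀ * (R i)⁻¹ * P.C i * Phi i = 0)
    (g : ProtocolGains N p q r)
    (hF : ∀ i, g.F i = Phi i * (P.C i)ᵀ * (R i)⁻¹)
    (hmu : ∀ i, 1 / (2 * G.eigenvalue i) ≤ g.μ i)
    (hK₁ : ∀ i, IsHurwitz (P.A i + P.B i * g.K₁ i))
    (hK₂ : ∀ i, g.K₂ i = Gam i - g.K₁ i * Pi i)
    (hbeta : 0 < g.β) :
    ContainmentControl.SolvesCooperativeOutputRegulation G P g := by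
  have hobs : ∀ i, IsHurwitz (P.A i - (g.μ i * G.eigenvalue i) • (g.F i * P.C i)) := by
    intro i
    have hpos := G.eigenvalue_pos hreach i
    -- The bound on `μ_i` is exactly the threshold `c ≥ 1/2` of the observer block.
    have hc : 1 / 2 ≤ g.μ i * G.eigenvalue i := by
      have h := mul_le_mul_of_nonneg_right (hmu i) hpos.le
      have h2 : 1 / (2 * G.eigenvalue i) * G.eigenvalue i = 1 / 2 := by field_simp
      linarith
    rw [hF]
    exact ContainmentControl.isHurwitz_observerBlock (hE i) (hR i) (hPhi i) (hARE i) hc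
  exact ContainmentControl.solvesCooperativeOutputRegulation_of_isHurwitz hacyclic hreach
    hreg_state hreg_output hK₂ (ContainmentControl.isHurwitz_closedLoopMatrix G P g hacyclic hreach
      (fun z hz => (hS z hz).1) hbeta hobs hK₁)
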